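/- A vector addition system with states (VASS) $V$ of dimension $d\in\mathbb{N}$ consists of a finite set $L$ of locations and a finite set $T\subseteq L\times\mathbb{Z}^d\times L$ of transitions. A state is a pair $(\ell,\nu)\in L\times\mathbb{N}^d$. There is a step from $(\ell_1,\nu_1)$ to $(\ell_2,\nu_2)$ with update $u\in\mathbb{Z}^d$ if $(\ell_1,u,\ell_2)\in T$ and $\nu_2=\nu_1+u$. A trace is a finite or infinite sequence of consecutive steps, and its length is the number of its steps. $V$ is terminating if it has no infinite trace, and connected if for all $\ell,\ell'\in L$ there is a (possibly empty) directed path of transitions from $\ell$ to $\ell'$. For $N\in\mathbb{N}$ let $\mathrm{comp}_N(V)$ be the length of the longest trace that starts in a state $(\ell,\nu)$ with $\nu(i)\le N$ for all $i$ (and $0$ if $L=\emptyset$). Let $D\in\mathbb{Z}^{d\times T}$ be the matrix whose column $t=(\ell,u,\ell')$ is $u$, and let $F\in\mathbb{Z}^{L\times T}$ be the oriented incidence matrix: if $t=(\ell_1,u,\ell_2)$ with $\ell_1\ne\ell_2$, then $F(\ell_1,t)=1$, $F(\ell_2,t)=-1$, and all other entries of column $t$ are $0$; if $\ell_1=\ell_2$,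 then column $t$ is $0$. Theorem. Let $V$ be a connected terminating VASS, and consider the linear program over $\rho\in\mathbb{Q}^T$ $$\max\ \mathbf{1}^T\rho\quad\text{subject to}\quad \rho\ge 0,\quad D\rho\ge-\mathbf{1},\quad F\rho=0.$$ Then $\mathrm{comp}_N(V)$ is finite for every $N$, and: 1. If the linear program has optimum $c\in\mathbb{Q}$, then $\mathrm{comp}_N(V)\sim cN$ as $N\to\infty$ (where $\sim 0$ means being eventually $0$). 2. If the linear program is unbounded, then the complexity of $V$ is at least quadratic, i.e. $\mathrm{comp}_N(V)\in\Omega(N^2)$. -/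

import Mathlib

open Filter Asymptotics
open scoped Matrix

/-- A vector addition system with states of dimension `d` with set of locations `L` (finite in the
theorem): a finite set of transitions `(ℓ, u, ℓ')` from `L × ℤ^d × L`. -/
structure VASS (L : Type*) (d : ℕ) where
  transitions : Finset (L × (Fin d → ℤ) × L)

namespace VASS

variable {L : Type*} {d : ℕ}

/-- States: pairs of a location and a valuation in `ℕ^d`. -/
abbrev State (L : Type*) (d : ℕ) := L × (Fin d → ℕ)

/-- `V.Step s u t`: the step from state `s` to state `t` with update `u`. -/
def Step (V : VASS L d) (s : State L d) (u : Fin d → ℤ) (t : State L d) : Prop :=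
  (s.1, u, t.1) ∈ V.transitions ∧ ∀ i, (t.2 i : ℤ) = (s.2 i : ℤ) + u i

/-- `V` is terminating if it has no infinite trace (from any initial state). -/
def Terminating (V : VASS L d) : Prop :=
  ¬ ∃ (σ : ℕ → State L d) (u : ℕ → Fin d → ℤ), ∀ i, V.Step (σ i) (u i) (σ (i + 1))

/-- `V` is connected if for all locations `ℓ`, `ℓ'` there is a (possibly empty) path from `ℓ` to
`ℓ'`; valuations play no role for paths. -/
def Connected (V : VASS L d) : Prop :=
  ∀ l l' : L, Relation.ReflTransGen (fun a b => ∃ u, (a, u, b) ∈ V.transitions) l l'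

/-- `V` has a trace of length `n` starting in the state `s`. Only the first `n + 1` states and the
first `n` updates of the sequences matter. -/
def HasTrace (V : VASS L d) (s : State L d) (n : ℕ) : Prop :=
  ∃ (σ : ℕ → State L d) (u : ℕ → Fin d → ℤ),
    σ 0 = s ∧ ∀ i < n, V.Step (σ i) (u i) (σ (i + 1))

/-- A state is `N`-bounded if every component of its valuation is at most `N`. -/
def Bounded (N : ℕ) (s : State L d) : Prop := ∀ i, s.2 i ≤ N

/-- The lengths of the traces that start from some `N`-bounded state. -/
def traceLengths (V : VASS L d) (N : ℕ) : Set ℕ :=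
  {n | ∃ s : State L d, Bounded N s ∧ V.HasTrace s n}

/-- The computational complexity: the length of the longest trace starting from some `N`-bounded
state. -/
noncomputable def comp (V : VASS L d) (N : ℕ) : ℕ := sSup (V.traceLengths N)

/-- The update matrix `D`: column `t = (ℓ, u, ℓ')` is the update `u`. -/
def updateMatrix (V : VASS L d) : Matrix (Fin d) V.transitions ℤ :=
  Matrix.of fun i t => t.1.2.1 i

/-- The oriented incidence matrix `F`: the entry in row `ℓ` and column `t` is `1` if `t` leaves
`ℓ`, `-1` if `t` enters `ℓ`, and `0` otherwise or if `t` is a self-loop. -/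
def flowMatrix [DecidableEq L] (V : VASS L d) : Matrix L V.transitions ℤ :=
  Matrix.of fun l t =>
    if t.1.1 = t.1.2.2 then 0
    else if t.1.1 = l then 1
    else if t.1.2.2 = l then -1
    else 0

/-- The feasible points of the rational linear program: `ρ ≥ 0`, `D ρ ≥ -1`, `F ρ = 0`. -/
def Feasible [DecidableEq L] (V : VASS L d) (ρ : V.transitions → ℚ) : Prop :=
  0 ≤ ρ ∧
  -1 ≤ V.updateMatrix.map (Int.cast : ℤ → ℚ) *ᵥ ρ ∧
  V.flowMatrix.map (Int.cast : ℤ → ℚ) *ᵥ ρ = 0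

/-- The values that the objective function `1ᵀ ρ` takes at the feasible points. -/
def objectiveValues [DecidableEq L] (V : VASS L d) : Set ℚ :=
  {c | ∃ ρ : V.transitions → ℚ, V.Feasible ρ ∧ ∑ t, ρ t = c}

end VASS

namespace VASS

variable {L : Type*} {d : ℕ}

/-! Count how often each transition occurs. A closed walk has a count vector in the kernel of `F`,
and its update is `D` times that vector. Conversely, a circulation added to the counts of a closed
walk visiting all locations is again the count vector of a closed walk
(`IsCirculation.exists_walk`).

Upper bound: a trace from an `N`-bounded state closes up by a path of bounded length, and dividing
the counts by `N + K` gives a feasible point. Hence `comp N ≤ c (N + K)`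
(`Connected.exists_feasible_of_trace`).

Lower bound: scale an optimal point to an integral circulation `a` losing at most `q`. Repeat a
closed walk containing `m • a`. The covering walk adds a fixed overhead `K` to the loss `m q` of
each round, so the ratio tends to `c` as `m` grows (`Connected.exists_mul_le_comp`,
`isEquivalent_mul_of_bounds`).

Unbounded case: rounding large feasible points and applying Dickson's lemma gives a nonzero
circulation with nonnegative update. A round containing `k` copies of it still loses at most `K`, so
`k` rounds with `k` proportional to `N` give length of order `N ^ 2`. -/

/-- `V.IsWalk x w y`: the list of transitions `w` is a directed path from `x` to `y`. -/
def IsWalk (V : VASS L d) : L → List V.transitions → L → Prop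
  | x, [], y => x = y
  | x, t :: w, y => t.1.1 = x ∧ IsWalk V t.1.2.2 w y

/-- The total update of a list of transitions. -/
def effect (V : VASS L d) (w : List V.transitions) (i : Fin d) : ℤ :=
  (w.map fun t => t.1.2.1 i).sum

/-- `V.Run s w t`: the transitions in `w` can be fired in order, leading from `s` to `t`. -/
def Run (V : VASS L d) : State L d → List V.transitions → State L d → Prop
  | s, [], t => s = t
  | s, a :: w, t => ∃ s' : State L d, a.1.1 = s.1 ∧ a.1.2.2 = s'.1 ∧
      (∀ i, (s'.2 i : ℤ) = (s.2 i : ℤ) + a.1.2.1 i) ∧ Run V s' w t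

/-! ### Walks, their transition counts, and circulations. -/

section Walks

variable {V : VASS L d}

@[simp] theorem effect_nil (i : Fin d) : V.effect [] i = 0 := by simp [effect]

@[simp] theorem effect_cons (t : V.transitions) (w : List V.transitions) (i : Fin d) :
    V.effect (t :: w) i = t.1.2.1 i + V.effect w i := by simp [effect]

@[simp] theorem effect_append (w₁ w₂ : List V.transitions) (i : Fin d) :
    V.effect (w₁ ++ w₂) i = V.effect w₁ i + V.effect w₂ i := by simp [effect]

theorem isWalk_append {w₁ w₂ : List V.transitions} {x z : L} :
    V.IsWalk x (w₁ ++ w₂) z ↔ ∃ y, V.IsWalk x w₁ y ∧ V.IsWalk y w₂ z := by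
  induction w₁ generalizing x with
  | nil => simp [IsWalk]
  | cons t w ih => simp [IsWalk, ih, and_assoc]

theorem IsWalk.append {w₁ w₂ : List V.transitions} {x y z : L} (h₁ : V.IsWalk x w₁ y)
    (h₂ : V.IsWalk y w₂ z) : V.IsWalk x (w₁ ++ w₂) z :=
  isWalk_append.2 ⟨y, h₁, h₂⟩

theorem IsWalk.eq_or_exists_mem {w : List V.transitions} {x y : L} (h : V.IsWalk x w y) :
    x = y ∨ ∃ t ∈ w, t.1.2.2 = y := by
  induction w generalizing x with
  | nil => exact Or.inl h
  | cons t w ih =>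
    rcases ih h.2 with h' | ⟨t', ht', rfl⟩
    · exact Or.inr ⟨t, by simp, h'⟩
    · exact Or.inr ⟨t', by simp [ht'], rfl⟩

theorem IsWalk.split_of_mem {w : List V.transitions} {x y : L} (h : V.IsWalk x w y)
    {t : V.transitions} (ht : t ∈ w) :
    ∃ w₁ w₂, w = w₁ ++ w₂ ∧ V.IsWalk x w₁ t.1.2.2 ∧ V.IsWalk t.1.2.2 w₂ y := by
  obtain ⟨s, r, rfl⟩ := List.append_of_mem ht
  obtain ⟨z, h₁, h₂⟩ := isWalk_append.1 h
  exact ⟨s ++ [t], r, by simp, h₁.append ⟨h₂.1, rfl⟩, h₂.2⟩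

theorem Connected.exists_isWalk (hconn : V.Connected) (x y : L) : ∃ w, V.IsWalk x w y := by
  induction hconn x y with
  | refl => exact ⟨[], rfl⟩
  | tail _ h ih =>
    obtain ⟨w, hw⟩ := ih
    obtain ⟨u, hu⟩ := h
    exact ⟨w ++ [⟨_, hu⟩], hw.append (show V.IsWalk _ [⟨_, hu⟩] _ from ⟨rfl, rfl⟩)⟩

/-- In a connected VASS there is a closed walk that visits all locations. -/
theorem Connected.exists_covering_walk [Finite L] (hconn : V.Connected) (x : L) :
    ∃ b, V.IsWalk x b x ∧ ∀ y, x = y ∨ ∃ t ∈ b, t.1.2.2 = y := by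
  have := Fintype.ofFinite L
  choose P hP using hconn.exists_isWalk
  have key : ∀ l : List L, ∃ b, V.IsWalk x b x ∧ ∀ y ∈ l, x = y ∨ ∃ t ∈ b, t.1.2.2 = y := by
    intro l
    induction l with
    | nil => exact ⟨[], rfl, by simp⟩
    | cons z l ih =>
      obtain ⟨b, hb, hv⟩ := ih
      refine ⟨P x z ++ (P z x ++ b), (hP x z).append ((hP z x).append hb), ?_⟩
      intro y hy
      rcases List.mem_cons.1 hy with rfl | hy
      · refine (hP x y).eq_or_exists_mem.imp id ?_
        rintro ⟨t, ht, h⟩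
        exact ⟨t, by simp [ht], h⟩
      · refine (hv y hy).imp id ?_
        rintro ⟨t, ht, h⟩
        exact ⟨t, by simp [ht], h⟩
  obtain ⟨b, hb, hv⟩ := key Finset.univ.toList
  exact ⟨b, hb, fun y => hv y (by simp)⟩

theorem sum_mul_count [DecidableEq L] (g : V.transitions → ℤ) (w : List V.transitions) :
    ∑ t, g t * (w.count t : ℤ) = (w.map g).sum := by
  induction w with
  | nil => simp
  | cons a w ih =>
    simp only [List.count_cons, List.map_cons, List.sum_cons, ← ih, Nat.cast_add, mul_add,
      Finset.sum_add_distrib]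
    rw [add_comm]
    simp

theorem effect_eq_sum [DecidableEq L] (w : List V.transitions) (i : Fin d) :
    V.effect w i = ∑ t, t.1.2.1 i * (w.count t : ℤ) :=
  (sum_mul_count _ _).symm

/-- For a self-loop the two indicators cancel, so no case distinction is needed. -/
theorem flowMatrix_apply [DecidableEq L] (l : L) (t : V.transitions) :
    V.flowMatrix l t = (if t.1.1 = l then 1 else 0) - (if t.1.2.2 = l then 1 else 0) := by
  simp only [flowMatrix, Matrix.of_apply]
  by_cases h : t.1.1 = t.1.2.2
  · simp [h]
  · by_cases h₁ : t.1.1 = l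
    · have : t.1.2.2 ≠ l := fun h₂ => h (h₁.trans h₂.symm)
      simp [h₁, this]
      intro h₂
      exact absurd h₂.symm this
    · by_cases h₂ : t.1.2.2 = l <;> simp [h, h₁, h₂]

theorem IsWalk.flow [DecidableEq L] {w : List V.transitions} {x y : L} (h : V.IsWalk x w y)
    (l : L) : ∑ t, V.flowMatrix l t * (w.count t : ℤ) =
      (if x = l then 1 else 0) - (if y = l then 1 else 0) := by
  rw [sum_mul_count]
  induction w generalizing x with
  | nil => obtain rfl : x = y := h; simp
  | cons t w ih =>
    obtain ⟨rfl, h'⟩ := h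
    simp only [List.map_cons, List.sum_cons, ih h', flowMatrix_apply]
    ring

/-- `a` is a nonnegative integral solution of `F a = 0`. -/
def IsCirculation [DecidableEq L] (V : VASS L d) (a : V.transitions → ℕ) : Prop :=
  ∀ l, ∑ t, V.flowMatrix l t * (a t : ℤ) = 0

theorem sum_count [DecidableEq L] (w : List V.transitions) : ∑ t, w.count t = w.length := by
  have := sum_mul_count (fun _ => 1) w
  simp only [one_mul, List.map_const', List.sum_replicate, mul_one, nsmul_eq_mul]
    at this
  exact_mod_cast this

/-- A walk within the budget `a` that has not returned to its start can always be extended, yet its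
length is at most the total of `a`. -/
theorem IsCirculation.exists_closed_walk [DecidableEq L] {a : V.transitions → ℕ}
    (ha : V.IsCirculation a) {t₀ : V.transitions} (ht₀ : 0 < a t₀) :
    ∃ x w, V.IsWalk x w x ∧ w ≠ [] ∧ ∀ t, w.count t ≤ a t := by
  by_contra hno
  have key : ∀ k : ℕ, ∃ w y, V.IsWalk t₀.1.1 w y ∧ w.length = k + 1 ∧ ∀ t, w.count t ≤ a t := by
    intro k
    induction k with
    | zero =>
      refine ⟨[t₀], t₀.1.2.2, ⟨rfl, rfl⟩, rfl, fun t => ?_⟩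
      by_cases h : t₀ = t
      · subst h; simpa using Nat.succ_le_of_lt ht₀
      · simp [h]
    | succ k ih =>
      obtain ⟨w, y, hw, hlen, hle⟩ := ih
      have hy : t₀.1.1 ≠ y := by
        rintro rfl
        exact hno ⟨_, w, hw, by rintro rfl; simp at hlen, hle⟩
      have h₁ := hw.flow y
      have h₂ := ha y
      -- The walk has net flow `-1` at its endpoint `y`, so the unused part of `a` has net outflow
      -- `1` there, and some unused transition leaves `y`.
      have h₃ : 0 < ∑ t, V.flowMatrix y t * ((a t : ℤ) - w.count t) := by
        simp only [mul_sub, Finset.sum_sub_distrib, h₁, h₂]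
        simp [hy]
      obtain ⟨t, -, ht⟩ := Finset.exists_lt_of_sum_lt (s := Finset.univ)
        (f := fun _ : V.transitions => (0 : ℤ)) (by simpa using h₃)
      have hle' : (0 : ℤ) ≤ (a t : ℤ) - w.count t := by have := hle t; omega
      have hF := pos_of_mul_pos_left ht hle'
      have hc : (0 : ℤ) < (a t : ℤ) - w.count t := pos_of_mul_pos_right ht hF.le
      have hsrc : t.1.1 = y := by
        by_contra hne
        rw [flowMatrix_apply, if_neg hne] at hF
        split_ifs at hF <;> omega
      refine ⟨w ++ [t], t.1.2.2, hw.append ⟨hsrc, rfl⟩, by simp [hlen], fun t' => ?_⟩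
      by_cases h : t = t'
      · subst h; simp; omega
      · simpa [List.count_append, List.count_cons, h] using hle t'
  obtain ⟨w, y, -, hlen, hle⟩ := key (∑ t, a t)
  have := Finset.sum_le_sum (s := Finset.univ) fun t _ => hle t
  rw [sum_count] at this
  omega

/-- A circulation added to a closed walk through all locations is again realised by a closed
walk. -/
theorem IsCirculation.exists_walk [DecidableEq L] {x : L} {b : List V.transitions}
    (hb : V.IsWalk x b x) (hcov : ∀ y, x = y ∨ ∃ t ∈ b, t.1.2.2 = y) {a : V.transitions → ℕ}
    (ha : V.IsCirculation a) :
    ∃ w, V.IsWalk x w x ∧ ∀ t, w.count t = a t + b.count t := by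
  induction hn : ∑ t, a t using Nat.strong_induction_on generalizing a with
  | _ n ih =>
    by_cases hz : ∀ t, a t = 0
    · exact ⟨b, hb, by simp [hz]⟩
    push Not at hz
    obtain ⟨t₀, ht₀⟩ := hz
    -- Remove a closed walk `c` from `a`, realise the rest by induction, and splice `c` back in.
    obtain ⟨y, c, hc, hne, hle⟩ := ha.exists_closed_walk (Nat.pos_of_ne_zero ht₀)
    have hadd : ∀ t, a t = (a t - c.count t) + c.count t := fun t => by have := hle t; omega
    have hcirc : V.IsCirculation fun t => a t - c.count t := by
      intro l
      have h₁ := hc.flow l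
      have h₂ := ha l
      have h₃ : ∀ t, ((a t - c.count t : ℕ) : ℤ) = (a t : ℤ) - c.count t := fun t => by
        have := hle t; omega
      simp only [h₃, mul_sub, Finset.sum_sub_distrib, h₁, h₂]
      simp
    have hlt : ∑ t, (a t - c.count t) < n := by
      have h₁ : ∑ t, a t = ∑ t, (a t - c.count t) + ∑ t, c.count t := by
        rw [← Finset.sum_add_distrib]
        exact Finset.sum_congr rfl fun t _ => hadd t
      rw [sum_count] at h₁
      have := List.length_pos_of_ne_nil hne
      omega
    obtain ⟨w, hw, hcount⟩ := ih _ hlt hcirc rfl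
    -- The walk `w` still uses every transition of `b`, so it visits `y`.
    have hsplit : ∃ w₁ w₂, w = w₁ ++ w₂ ∧ V.IsWalk x w₁ y ∧ V.IsWalk y w₂ x := by
      rcases hcov y with rfl | ⟨t, ht, rfl⟩
      · exact ⟨[], w, rfl, rfl, hw⟩
      · refine hw.split_of_mem (List.count_pos_iff.1 ?_)
        rw [hcount]
        have := List.count_pos_iff.2 ht
        omega
    obtain ⟨w₁, w₂, rfl, h₁, h₂⟩ := hsplit
    refine ⟨w₁ ++ (c ++ w₂), h₁.append (hc.append h₂), fun t => ?_⟩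
    have := hcount t
    have := hadd t
    simp only [List.count_append] at *
    omega

end Walks

/-! ### Firing walks from valuations, and finiteness of trace lengths. -/

section Runs

variable {V : VASS L d}

theorem Run.append {s t r : State L d} {w₁ w₂ : List V.transitions} (h₁ : V.Run s w₁ t)
    (h₂ : V.Run t w₂ r) : V.Run s (w₁ ++ w₂) r := by
  induction w₁ generalizing s with
  | nil => obtain rfl : s = t := h₁; exact h₂
  | cons a w ih =>
    obtain ⟨s', h, h', h'', hr⟩ := h₁
    exact ⟨s', h, h', h'', ih hr⟩

theorem Run.isWalk {s t : State L d} {w : List V.transitions} (h : V.Run s w t) :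
    V.IsWalk s.1 w t.1 := by
  induction w generalizing s with
  | nil => obtain rfl : s = t := h; rfl
  | cons a w ih =>
    obtain ⟨s', h₁, h₂, -, hr⟩ := h
    refine ⟨h₁, ?_⟩
    rw [h₂]
    exact ih hr

theorem Run.effect {s t : State L d} {w : List V.transitions} (h : V.Run s w t) (i : Fin d) :
    (t.2 i : ℤ) = s.2 i + V.effect w i := by
  induction w generalizing s with
  | nil => obtain rfl : s = t := h; simp
  | cons a w ih =>
    obtain ⟨s', -, -, h, hr⟩ := h
    rw [ih hr, h, effect_cons, add_assoc]

theorem hasTrace_succ {s : State L d} {n : ℕ} :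
    V.HasTrace s (n + 1) ↔ ∃ u s', V.Step s u s' ∧ V.HasTrace s' n := by
  constructor
  · rintro ⟨σ, u, rfl, h⟩
    exact ⟨u 0, σ 1, h 0 (by omega), fun i => σ (i + 1), fun i => u (i + 1), rfl,
      fun i hi => h (i + 1) (by omega)⟩
  · rintro ⟨u, s', h, σ, v, rfl, hσ⟩
    refine ⟨fun i => Nat.casesOn i s σ, fun i => Nat.casesOn i u v, rfl, fun i hi => ?_⟩
    cases i with
    | zero => exact h
    | succ i => exact hσ i (by omega)

theorem hasTrace_iff_run {s : State L d} {n : ℕ} :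
    V.HasTrace s n ↔ ∃ w t, V.Run s w t ∧ w.length = n := by
  induction n generalizing s with
  | zero =>
    constructor
    · intro _
      exact ⟨[], s, rfl, rfl⟩
    · intro _
      exact ⟨fun _ => s, fun _ => 0, rfl, by simp⟩
  | succ n ih =>
    rw [hasTrace_succ]
    constructor
    · rintro ⟨u, s', ⟨hm, hu⟩, h⟩
      obtain ⟨w, t, hr, hl⟩ := ih.1 h
      exact ⟨⟨_, hm⟩ :: w, t, ⟨s', rfl, rfl, hu, hr⟩, by simp [hl]⟩
    · rintro ⟨w, t, hr, hl⟩
      cases w with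
      | nil => simp at hl
      | cons a w =>
        obtain ⟨s', h₁, h₂, h₃, hr⟩ := hr
        refine ⟨a.1.2.1, s', ⟨?_, h₃⟩, ih.2 ⟨w, t, hr, by simpa using hl⟩⟩
        rw [← h₁, ← h₂]
        exact a.2

theorem exists_update_bound (V : VASS L d) :
    ∃ M : ℕ, ∀ (t : V.transitions) (i : Fin d), |t.1.2.1 i| ≤ M := by
  obtain ⟨M, hM⟩ := (Set.finite_range fun p : V.transitions × Fin d =>
    (p.1.1.2.1 p.2).natAbs).bddAbove
  refine ⟨M, fun t i => ?_⟩
  have := hM ⟨(t, i), rfl⟩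
  rw [Int.abs_eq_natAbs]
  exact_mod_cast this

theorem abs_effect_le {M : ℕ} (hM : ∀ (t : V.transitions) (i : Fin d), |t.1.2.1 i| ≤ M)
    (w : List V.transitions) (i : Fin d) : |V.effect w i| ≤ M * w.length := by
  induction w with
  | nil => simp
  | cons t w ih =>
    have h₁ := abs_add_le (t.1.2.1 i) (V.effect w i)
    have h₂ := hM t i
    rw [effect_cons]
    push_cast [List.length_cons]
    linarith

/-- A walk can be fired from every sufficiently large valuation. -/
theorem IsWalk.exists_run {M : ℕ} (hM : ∀ (t : V.transitions) (i : Fin d), |t.1.2.1 i| ≤ M)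
    {w : List V.transitions} {x y : L} (h : V.IsWalk x w y) {v : Fin d → ℕ}
    (hv : ∀ i, M * w.length ≤ v i) : ∃ v', V.Run (x, v) w (y, v') := by
  induction w generalizing x v with
  | nil => exact ⟨v, by obtain rfl : x = y := h; rfl⟩
  | cons t w ih =>
    have hstep : ∀ i, (M * w.length : ℤ) ≤ v i + t.1.2.1 i := fun i => by
      have h₁ := hv i
      have h₂ := neg_le_of_abs_le (hM t i)
      have h₃ : ((M * (t :: w).length : ℕ) : ℤ) ≤ v i := by exact_mod_cast h₁
      push_cast [List.length_cons] at h₃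
      linarith
    have hcast : ∀ i, ((v i + t.1.2.1 i).toNat : ℤ) = v i + t.1.2.1 i := fun i =>
      Int.toNat_of_nonneg (le_trans (by positivity) (hstep i))
    obtain ⟨v', hr⟩ := ih h.2 (v := fun i => (v i + t.1.2.1 i).toNat) fun i => by
      have := hstep i
      rw [← hcast i] at this
      exact_mod_cast this
    exact ⟨v', (t.1.2.2, fun i => (v i + t.1.2.1 i).toNat), h.1, rfl, hcast, hr⟩

/-- Repeating a closed walk with total update at least `-e`. -/
theorem IsWalk.hasTrace_mul {M e : ℕ} (hM : ∀ (t : V.transitions) (i : Fin d), |t.1.2.1 i| ≤ M)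
    {w : List V.transitions} {x : L} (h : V.IsWalk x w x) (he : ∀ i, -(e : ℤ) ≤ V.effect w i)
    (j : ℕ) {v : Fin d → ℕ} (hv : ∀ i, j * e + M * w.length ≤ v i) :
    V.HasTrace (x, v) (j * w.length) := by
  suffices ∃ w' t, V.Run (x, v) w' t ∧ w'.length = j * w.length from hasTrace_iff_run.2 this
  induction j generalizing v with
  | zero => exact ⟨[], _, rfl, by simp⟩
  | succ j ih =>
    -- The summand `M * w.length` is a reserve that suffices to fire one round; completing the round
    -- consumes at most `e`.
    obtain ⟨v', hr⟩ := h.exists_run hM fun i => le_trans (Nat.le_add_left _ _) (hv i)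
    obtain ⟨w', t, hr', hl⟩ := ih (v := v') fun i => by
      have h₁ := hr.effect i
      have h₂ := he i
      have h₃ := hv i
      simp only at h₁
      rw [add_mul, one_mul] at h₃
      omega
    exact ⟨w ++ w', t, hr.append hr', by simp [hl, add_mul, add_comm]⟩

/-- König's lemma, as induction along the well-founded successor relation: each transition yields at
most one successor, so branching is finite. -/
theorem Terminating.exists_bound (hterm : V.Terminating) (s : State L d) :
    ∃ B, ∀ n, V.HasTrace s n → n ≤ B := by
  have hwf : WellFounded fun s' s : State L d => ∃ u, V.Step s u s' := by
    rw [wellFounded_iff_isEmpty_descending_chain]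
    refine ⟨fun ⟨σ, hσ⟩ => hterm ?_⟩
    choose u hu using hσ
    exact ⟨σ, u, hu⟩
  induction s using hwf.induction with
  | _ s ih =>
    have key : ∀ t : V.transitions, ∃ B, ∀ s' : State L d, t.1.1 = s.1 → t.1.2.2 = s'.1 →
        V.Step s t.1.2.1 s' → ∀ n, V.HasTrace s' n → n ≤ B := by
      intro t
      by_cases hex : ∃ s' : State L d, t.1.2.2 = s'.1 ∧ V.Step s t.1.2.1 s'
      · obtain ⟨r, hr, hstep⟩ := hex
        obtain ⟨B, hB⟩ := ih r ⟨_, hstep⟩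
        refine ⟨B, fun s' _ h₂ h₃ => ?_⟩
        have : s' = r := Prod.ext (h₂.symm.trans hr) (funext fun i => by
          have h₄ := h₃.2 i
          have h₅ := hstep.2 i
          omega)
        rwa [this]
      · exact ⟨0, fun s' _ h₂ h₃ => absurd ⟨s', h₂, h₃⟩ hex⟩
    choose B hB using key
    refine ⟨(∑ t, B t) + 1, fun n hn => ?_⟩
    cases n with
    | zero => omega
    | succ n =>
      obtain ⟨u, s', hstep, hs'⟩ := hasTrace_succ.1 hn
      have h₁ := hB ⟨_, hstep.1⟩ s' rfl rfl hstep n hs'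
      have h₂ := Finset.single_le_sum (f := B) (fun _ _ => Nat.zero_le _)
        (Finset.mem_univ ⟨_, hstep.1⟩)
      omega

theorem Terminating.bddAbove_traceLengths [Finite L] (hterm : V.Terminating) (N : ℕ) :
    BddAbove (V.traceLengths N) := by
  choose B hB using hterm.exists_bound
  have hfin : {s : State L d | Bounded N s}.Finite := by
    refine (Set.finite_univ.prod (Set.Finite.pi' fun _ : Fin d => Set.finite_Iic N)).subset ?_
    intro s hs
    exact ⟨trivial, hs⟩
  obtain ⟨C, hC⟩ := (hfin.image B).bddAbove
  refine ⟨C, ?_⟩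
  rintro n ⟨s, hs, hn⟩
  exact (hB s n hn).trans (hC ⟨s, hs, rfl⟩)

end Runs

/-! ### Translation between traces and points of the linear program. -/

section Bounds

variable {L : Type*} {d : ℕ} [DecidableEq L] {V : VASS L d}

theorem feasible_iff {ρ : V.transitions → ℚ} : V.Feasible ρ ↔ (∀ t, 0 ≤ ρ t) ∧
    (∀ i, -1 ≤ ∑ t, (t.1.2.1 i : ℚ) * ρ t) ∧ ∀ l, ∑ t, (V.flowMatrix l t : ℚ) * ρ t = 0 := by
  simp only [Feasible, Pi.le_def, funext_iff, Matrix.mulVec, dotProduct, Matrix.map_apply,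
    updateMatrix, Matrix.of_apply, Pi.zero_apply, Pi.neg_apply, Pi.one_apply]

theorem Feasible.of_scaled {a : V.transitions → ℕ} (ha : V.IsCirculation a) {q : ℕ} (hq : 0 < q)
    (hD : ∀ i, -(q : ℤ) ≤ ∑ t, t.1.2.1 i * (a t : ℤ)) : V.Feasible fun t => (a t : ℚ) / q := by
  have hq' : (0 : ℚ) < q := by exact_mod_cast hq
  refine feasible_iff.2 ⟨fun t => by positivity, fun i => ?_, fun l => ?_⟩
  · have h := hD i
    have h' : -(q : ℚ) ≤ ∑ t, (t.1.2.1 i : ℚ) * (a t : ℚ) := by exact_mod_cast h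
    simp only [← mul_div_assoc, ← Finset.sum_div]
    rw [le_div_iff₀ hq']
    linarith
  · have h := ha l
    have h' : ∑ t, (V.flowMatrix l t : ℚ) * (a t : ℚ) = 0 := by exact_mod_cast h
    simp only [← mul_div_assoc, ← Finset.sum_div, h', zero_div]

/-- Closing a trace to a cycle and scaling it down gives a feasible point. -/
theorem Connected.exists_feasible_of_trace [Finite L] (hconn : V.Connected) :
    ∃ K : ℕ, ∀ N, ∀ n ∈ V.traceLengths N, ∃ ρ, V.Feasible ρ ∧ (n : ℚ) ≤ (N + K) * ∑ t, ρ t := by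
  obtain ⟨M, hM⟩ := V.exists_update_bound
  choose P hP using hconn.exists_isWalk
  obtain ⟨C, hC⟩ := (Set.finite_range fun p : L × L => (P p.1 p.2).length).bddAbove
  -- `M * C` pays for the closing path; `+ 1` keeps the divisor positive when `N = 0`.
  refine ⟨M * C + 1, ?_⟩
  rintro N n ⟨s, hs, hn⟩
  obtain ⟨w, t, hr, rfl⟩ := hasTrace_iff_run.1 hn
  have hlen : (P t.1 s.1).length ≤ C := hC ⟨(t.1, s.1), rfl⟩
  have hclosed := hr.isWalk.append (hP t.1 s.1)
  have hpos : 0 < N + (M * C + 1) := by omega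
  refine ⟨_, Feasible.of_scaled (a := fun r => (w ++ P t.1 s.1).count r) (q := N + (M * C + 1))
    (fun l => by simpa using hclosed.flow l) hpos fun i => ?_, ?_⟩
  · rw [← effect_eq_sum, effect_append]
    have h₁ := hr.effect i
    have h₂ := neg_le_of_abs_le (abs_effect_le hM (P t.1 s.1) i)
    have h₃ : (M : ℤ) * (P t.1 s.1).length ≤ M * C := by gcongr
    have h₄ := hs i
    push_cast
    have h₅ : (0 : ℤ) ≤ t.2 i := by positivity
    have h₆ : (s.2 i : ℤ) ≤ N := by exact_mod_cast h₄
    linarith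
  · rw [← Finset.sum_div, ← Nat.cast_sum, sum_count, ← Nat.cast_add, mul_div_cancel₀]
    · simp
    · exact_mod_cast hpos.ne'

/-- Long traces obtained by repeating a circulation `a` with total update at least `-q`. -/
theorem Connected.exists_mul_le_comp [Finite L] [Nonempty L] (hconn : V.Connected)
    (hterm : V.Terminating) : ∃ K M : ℕ, ∀ a : V.transitions → ℕ, V.IsCirculation a → ∀ q : ℕ,
      (∀ i, -(q : ℤ) ≤ ∑ t, t.1.2.1 i * (a t : ℤ)) →
      ∀ j N, j * (q + K) + M * (∑ t, a t + K) ≤ N → j * ∑ t, a t ≤ V.comp N := by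
  obtain ⟨M, hM⟩ := V.exists_update_bound
  obtain ⟨x⟩ := ‹Nonempty L›
  obtain ⟨b, hb, hcov⟩ := hconn.exists_covering_walk x
  -- `M * b.length` bounds the loss along `b`; the extra `b.length` makes the constant also dominate
  -- the length of `b`.
  refine ⟨(M + 1) * b.length, M, fun a ha q hq j N hN => ?_⟩
  obtain ⟨w, hw, hcount⟩ := ha.exists_walk hb hcov
  have hlen : w.length = ∑ t, a t + b.length := by
    rw [← sum_count, ← sum_count, ← Finset.sum_add_distrib]
    exact Finset.sum_congr rfl fun t _ => hcount t
  have heff : ∀ i, -((q + (M + 1) * b.length : ℕ) : ℤ) ≤ V.effect w i := fun i => by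
    have h₁ := hq i
    have h₂ := neg_le_of_abs_le (abs_effect_le hM b i)
    rw [effect_eq_sum] at h₂ ⊢
    simp only [hcount, Nat.cast_add, mul_add, Finset.sum_add_distrib]
    push_cast
    linarith [(Nat.cast_nonneg b.length : (0 : ℤ) ≤ b.length)]
  have htr := hw.hasTrace_mul hM heff j (v := fun _ => N) fun i => by
    refine le_trans ?_ hN
    rw [hlen]
    gcongr
    exact Nat.le_mul_of_pos_left _ (Nat.succ_pos M)
  have h₁ : j * w.length ≤ V.comp N :=
    le_csSup (hterm.bddAbove_traceLengths N) ⟨_, fun i => le_rfl, htr⟩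
  refine le_trans ?_ h₁
  gcongr
  omega

/-- Clearing denominators of a feasible point. -/
theorem Feasible.exists_circulation {ρ : V.transitions → ℚ} (hρ : V.Feasible ρ) :
    ∃ (q : ℕ) (a : V.transitions → ℕ), 0 < q ∧ (∀ t, (a t : ℚ) = q * ρ t) ∧ V.IsCirculation a ∧
      ∀ i, -(q : ℤ) ≤ ∑ t, t.1.2.1 i * (a t : ℤ) := by
  obtain ⟨h₀, hD, hF⟩ := feasible_iff.1 hρ
  have hq : 0 < ∏ t, (ρ t).den := Finset.prod_pos fun t _ => (ρ t).den_pos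
  have hint : ∀ t, ∃ n : ℕ, (n : ℚ) = (∏ t, (ρ t).den : ℕ) * ρ t := fun t => by
    obtain ⟨k, hk⟩ := Finset.dvd_prod_of_mem (fun t => (ρ t).den) (Finset.mem_univ t)
    refine ⟨(ρ t).num.toNat * k, ?_⟩
    have h₁ : (((ρ t).num.toNat : ℤ) : ℚ) = (ρ t).num := by
      rw [Int.toNat_of_nonneg (Rat.num_nonneg.2 (h₀ t))]
    have h₂ := Rat.mul_den_eq_num (ρ t)
    rw [hk]
    push_cast at h₁ ⊢
    rw [h₁, ← h₂]
    ring
  choose a ha using hint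
  refine ⟨_, a, hq, ha, fun l => ?_, fun i => ?_⟩
  · have h : ∑ t, (V.flowMatrix l t : ℚ) * (a t : ℚ) = 0 := by
      simp only [ha, mul_left_comm _ (((∏ t, (ρ t).den : ℕ) : ℚ)), ← Finset.mul_sum, hF l,
        mul_zero]
    exact_mod_cast h
  · generalize (∏ t, (ρ t).den) = q at *
    have h : -(q : ℚ) ≤ ∑ t, (t.1.2.1 i : ℚ) * (a t : ℚ) := by
      simp only [ha, mul_left_comm _ (q : ℚ), ← Finset.mul_sum]
      have := mul_le_mul_of_nonneg_left (hD i) (Nat.cast_nonneg q : (0 : ℚ) ≤ q)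
      linarith
    exact_mod_cast h

/-- The rounding error does not depend on `ρ`, so arbitrarily large feasible points round to
integral vectors with uniformly bounded constraint violation. -/
theorem abs_sum_mul_floor_sub_le {ι : Type*} [Fintype ι] (g : ι → ℤ) {ρ : ι → ℚ}
    (h : ∀ t, 0 ≤ ρ t) :
    |(∑ t, g t * (⌊ρ t⌋₊ : ℤ) : ℤ) - ∑ t, (g t : ℚ) * ρ t| ≤ ∑ t, |(g t : ℚ)| := by
  push_cast
  rw [← Finset.sum_sub_distrib]
  refine (Finset.abs_sum_le_sum_abs _ _).trans (Finset.sum_le_sum fun t _ => ?_)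
  rw [← mul_sub, abs_mul]
  refine mul_le_of_le_one_right (abs_nonneg _) (abs_le.2 ⟨?_, ?_⟩)
  · linarith [Nat.lt_floor_add_one (ρ t)]
  · linarith [Nat.floor_le (h t)]

/-- If the linear program is unbounded, there is a nonzero circulation with nonnegative update. -/
theorem exists_circulation_of_not_bddAbove [Finite L] (h : ¬ BddAbove V.objectiveValues) :
    ∃ a : V.transitions → ℕ, V.IsCirculation a ∧ 0 < ∑ t, a t ∧
      ∀ i, 0 ≤ ∑ t, t.1.2.1 i * (a t : ℤ) := by
  have hex : ∀ n : ℕ, ∃ ρ, V.Feasible ρ ∧ (n : ℚ) < ∑ t, ρ t := by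
    intro n
    rw [not_bddAbove_iff] at h
    obtain ⟨_, ⟨ρ, hρ, rfl⟩, hn⟩ := h n
    exact ⟨ρ, hρ, hn⟩
  have hbig : ∀ n : ℕ, ∃ a : V.transitions → ℕ, n < ∑ t, a t ∧
      (∀ i, -(1 + ∑ t : V.transitions, |t.1.2.1 i|) ≤ ∑ t, t.1.2.1 i * (a t : ℤ)) ∧
      ∀ l, |∑ t, V.flowMatrix l t * (a t : ℤ)| ≤ ∑ t, |V.flowMatrix l t| := by
    intro n
    obtain ⟨ρ, hρ, hn⟩ := hex (n + Fintype.card V.transitions)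
    obtain ⟨h₀, hD, hF⟩ := feasible_iff.1 hρ
    refine ⟨fun t => ⌊ρ t⌋₊, ?_, fun i => ?_, fun l => ?_⟩
    · have h₁ := abs_sum_mul_floor_sub_le (fun _ => 1) h₀
      have h₂ := neg_le_of_abs_le h₁
      simp only [Int.cast_one, one_mul, abs_one, Finset.sum_const, Finset.card_univ,
        nsmul_eq_mul, mul_one] at h₂
      push_cast at h₂ hn
      have : (n : ℚ) < ∑ t, (⌊ρ t⌋₊ : ℚ) := by linarith
      exact_mod_cast this
    · have h₂ := neg_le_of_abs_le (abs_sum_mul_floor_sub_le (fun t => t.1.2.1 i) h₀)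
      have h₃ := hD i
      have : -(1 + ∑ t : V.transitions, |(t.1.2.1 i : ℚ)|) ≤
          ((∑ t, t.1.2.1 i * (⌊ρ t⌋₊ : ℤ) : ℤ) : ℚ) := by linarith
      exact_mod_cast this
    · have h₂ := abs_sum_mul_floor_sub_le (fun t => V.flowMatrix l t) h₀
      rw [hF l, sub_zero] at h₂
      exact_mod_cast h₂
  choose f hf using hbig
  -- Strictly increasing totals make the difference of any two terms nonzero.
  obtain ⟨A, hA, hmono⟩ : ∃ A : ℕ → V.transitions → ℕ, (∀ n, ∃ m, A n = f m) ∧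
      StrictMono fun n => ∑ t, A n t := by
    refine ⟨fun n => Nat.rec (f 0) (fun _ g => f (∑ t, g t)) n, fun n => ?_,
      strictMono_nat_of_lt_succ fun n => (hf _).1⟩
    cases n <;> exact ⟨_, rfl⟩
  have hDA : ∀ n i, 0 ≤ (1 + ∑ t : V.transitions, |t.1.2.1 i|) +
      ∑ t : V.transitions, t.1.2.1 i * (A n t : ℤ) := fun n i => by
    obtain ⟨m, hm⟩ := hA n
    have := (hf m).2.1 i
    rw [hm]
    linarith
  have hFA : ∀ n l, |∑ t, V.flowMatrix l t * (A n t : ℤ)| ≤ ∑ t, |V.flowMatrix l t| :=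
    fun n l => by
      obtain ⟨m, hm⟩ := hA n
      rw [hm]
      exact (hf m).2.2 l
  -- The shifts make all entries nonnegative, so `toNat` loses nothing. Recording the flow with both
  -- signs turns `≤` into equality, so the difference of two comparable terms is a circulation.
  let Φ : ℕ → (V.transitions → ℕ) × (Fin d → ℕ) × (L → ℕ) × (L → ℕ) := fun n =>
    (A n,
      fun i => ((1 + ∑ t : V.transitions, |t.1.2.1 i|) + ∑ t : V.transitions, t.1.2.1 i * (A n t : ℤ)).toNat,
      fun l => (∑ t, |V.flowMatrix l t| + ∑ t, V.flowMatrix l t * (A n t : ℤ)).toNat,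
      fun l => (∑ t, |V.flowMatrix l t| - ∑ t, V.flowMatrix l t * (A n t : ℤ)).toNat)
  obtain ⟨m, n, hmn, hle⟩ := wellQuasiOrdered_le Φ
  obtain ⟨hle₁, hle₂, hle₃, hle₄⟩ := hle
  have hsub : ∀ t, ((A n t - A m t : ℕ) : ℤ) = (A n t : ℤ) - A m t := fun t => by
    have : A m t ≤ A n t := hle₁ t
    omega
  refine ⟨fun t => A n t - A m t, fun l => ?_, ?_, fun i => ?_⟩
  · simp only [hsub, mul_sub, Finset.sum_sub_distrib]
    have h₁ := hle₃ l
    have h₂ := hle₄ l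
    have h₃ := abs_le.1 (hFA n l)
    have h₄ := abs_le.1 (hFA m l)
    simp only [Φ] at h₁ h₂
    omega
  · have h₁ : ∑ t, A n t = ∑ t, (A n t - A m t) + ∑ t, A m t := by
      rw [← Finset.sum_add_distrib]
      refine Finset.sum_congr rfl fun t _ => ?_
      have : A m t ≤ A n t := hle₁ t
      omega
    have h₂ : ∑ t, A m t < ∑ t, A n t := hmono hmn
    exact Nat.pos_of_lt_add_left (h₁ ▸ h₂)
  · simp only [hsub, mul_sub, Finset.sum_sub_distrib]
    have h₁ := hle₂ i
    have h₂ := hDA n i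
    have h₃ := hDA m i
    simp only [Φ] at h₁
    omega

end Bounds

/-! ### From linear bounds to asymptotic equivalence. -/

/-- An upper bound `c (N + K)` and lower bounds `m c q (N - C) / (m q + K)` for all `m` force
`f N ∼ c N`. -/
theorem isEquivalent_mul_of_bounds {f : ℕ → ℝ} {c q K₁ K₂ : ℝ} (hc : 0 < c) (hq : 0 < q)
    (hK₂ : 0 ≤ K₂) (hupper : ∀ N : ℕ, f N ≤ c * (N + K₁))
    (hlower : ∀ m : ℕ, ∃ C : ℝ, ∀ N : ℕ,
      m * (c * q) * (N - C) ≤ (m * q + K₂) * f N) :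
    f ~[atTop] fun N : ℕ => c * (N : ℝ) := by
  refine IsLittleO.of_bound fun ε hε => ?_
  -- Half of the relative error `ε` absorbs the overhead `K₂` against `m * q`, the other half
  -- absorbs `C`.
  obtain ⟨m, hm⟩ := exists_nat_gt (2 * K₂ / (ε * q))
  obtain ⟨C, hC⟩ := hlower (m + 1)
  filter_upwards [eventually_ge_atTop ⌈K₁ / ε⌉₊, eventually_ge_atTop ⌈2 * |C| / ε⌉₊] with N h₁ h₂
  have hN₁ : K₁ ≤ ε * N := by
    have := Nat.ceil_le.1 h₁
    rw [div_le_iff₀ hε] at this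
    linarith
  have hN₂ : 2 * |C| ≤ ε * N := by
    have := Nat.ceil_le.1 h₂
    rw [div_le_iff₀ hε] at this
    linarith
  have hN : (0 : ℝ) ≤ N := Nat.cast_nonneg N
  have hmq : 2 * K₂ ≤ ε * ((m + 1 : ℕ) * q) := by
    rw [div_lt_iff₀ (by positivity)] at hm
    push_cast
    nlinarith [mul_pos hε hq]
  have hCN := hC N
  have hp : (0 : ℝ) < (m + 1 : ℕ) := by positivity
  generalize (((m + 1 : ℕ) : ℝ)) = p at *
  simp only [Pi.sub_apply, Real.norm_eq_abs]
  rw [abs_of_nonneg (mul_nonneg hc.le hN), abs_le]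
  constructor
  · have hpq : 0 < p * q := mul_pos hp hq
    have h₃ : p * q * (2 * C) ≤ p * q * (ε * N) := by
      have := le_abs_self C
      exact mul_le_mul_of_nonneg_left (by linarith) hpq.le
    have h₄ := mul_le_mul_of_nonneg_right hmq hN
    have h₅ : 0 ≤ ε * K₂ * N := by positivity
    have h₆ : c * ((p * q + K₂) * (N - ε * N)) ≤ c * (p * q * (N - C)) :=
      mul_le_mul_of_nonneg_left (by linarith) hc.le
    have h₇ : (p * q + K₂) * (c * N - ε * (c * N)) ≤ (p * q + K₂) * f N := by linarith
    have := le_of_mul_le_mul_left h₇ (by positivity)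
    linarith
  · have := hupper N
    have := mul_le_mul_of_nonneg_left hN₁ hc.le
    linarith

/-! ### Growth of the complexity in the bounded and unbounded cases. -/

section Asymptotics

variable {L : Type*} {d : ℕ} {V : VASS L d}

theorem zero_mem_objectiveValues [DecidableEq L] : (0 : ℚ) ∈ V.objectiveValues :=
  ⟨0, feasible_iff.2 ⟨by simp, by simp, by simp⟩, by simp⟩

theorem comp_of_isEmpty [IsEmpty L] (N : ℕ) : V.comp N = 0 := by
  have : V.traceLengths N = ∅ := by
    ext n
    refine iff_of_false ?_ (Set.notMem_empty n)
    rintro ⟨s, -⟩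
    exact isEmptyElim s.1
  simp [comp, this]

theorem comp_mem_traceLengths [Finite L] [Nonempty L] (hterm : V.Terminating) (N : ℕ) :
    V.comp N ∈ V.traceLengths N := by
  obtain ⟨x⟩ := ‹Nonempty L›
  refine Nat.sSup_mem ⟨0, (x, fun _ => 0), fun i => Nat.zero_le _, ?_⟩
    (hterm.bddAbove_traceLengths N)
  exact hasTrace_iff_run.2 ⟨[], _, rfl, rfl⟩

variable [DecidableEq L] [Finite L]

theorem Connected.exists_comp_le (hconn : V.Connected) (hterm : V.Terminating) {c : ℚ}
    (hc : IsGreatest V.objectiveValues c) :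
    ∃ K : ℕ, ∀ N : ℕ, (V.comp N : ℚ) ≤ c * (N + K) := by
  have hc₀ : 0 ≤ c := hc.2 zero_mem_objectiveValues
  obtain ⟨K, hK⟩ := hconn.exists_feasible_of_trace
  refine ⟨K, fun N => ?_⟩
  cases isEmpty_or_nonempty L
  · rw [comp_of_isEmpty, Nat.cast_zero]
    positivity
  · obtain ⟨ρ, hρ, h⟩ := hK N _ (comp_mem_traceLengths hterm N)
    have h' : ∑ t, ρ t ≤ c := hc.2 ⟨ρ, hρ, rfl⟩
    refine h.trans ?_
    rw [mul_comm]
    gcongr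

theorem Connected.comp_isEquivalent (hconn : V.Connected) (hterm : V.Terminating) {c : ℚ}
    (hc : IsGreatest V.objectiveValues c) :
    (fun N : ℕ => (V.comp N : ℝ)) ~[atTop] fun N : ℕ => (c : ℝ) * (N : ℝ) := by
  obtain ⟨K₁, hK₁⟩ := hconn.exists_comp_le hterm hc
  have hc₀ : 0 ≤ c := hc.2 zero_mem_objectiveValues
  rcases hc₀.eq_or_lt with rfl | hc₀
  -- Equivalence to `0` means eventual equality, and here the upper bound forces it for every `N`.
  · have : ∀ N, V.comp N = 0 := fun N => by
      have := hK₁ N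
      rw [zero_mul] at this
      exact_mod_cast this.antisymm (Nat.cast_nonneg _)
    simp only [this, Nat.cast_zero, Rat.cast_zero, zero_mul]
    exact IsEquivalent.refl
  obtain ⟨ρ, hρ, hsum⟩ := hc.1
  obtain ⟨q, a, hq, haρ, ha, hD⟩ := hρ.exists_circulation
  have hsum_a : ((∑ t, a t : ℕ) : ℚ) = c * q := by
    push_cast
    simp only [haρ, ← Finset.mul_sum, hsum]
    rw [mul_comm]
  have hsum_a' : ((∑ t, a t : ℕ) : ℝ) = c * q := by exact_mod_cast hsum_a
  have : Nonempty L := by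
    by_contra hL
    rw [not_nonempty_iff] at hL
    have hz : ∑ t, ρ t = 0 := Finset.sum_eq_zero fun t _ => isEmptyElim t.1.1
    exact hc₀.ne (hz.symm.trans hsum)
  obtain ⟨K₂, M, hlow⟩ := hconn.exists_mul_le_comp hterm
  refine isEquivalent_mul_of_bounds (q := q) (K₁ := K₁) (K₂ := K₂) (by exact_mod_cast hc₀)
    (by exact_mod_cast hq) (Nat.cast_nonneg _) (fun N => by exact_mod_cast hK₁ N) (fun m => ?_)
  obtain ⟨s, hs⟩ : ∃ s, s = ∑ t, a t := ⟨_, rfl⟩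
  rw [← hs] at hsum_a'
  rcases Nat.eq_zero_or_pos m with rfl | hm
  · refine ⟨0, fun N => ?_⟩
    rw [Nat.cast_zero, zero_mul, zero_mul]
    positivity
  -- The first summand is the reserve for firing a round; the second covers rounding down the number
  -- `j` of rounds.
  refine ⟨(M * (m * s + K₂) + (m * q + K₂) : ℕ), fun N => ?_⟩
  rw [← hsum_a']
  by_cases hN : N < M * (m * s + K₂) + (m * q + K₂)
  · have h₁ : (N : ℝ) < (M * (m * s + K₂) + (m * q + K₂) : ℕ) := by exact_mod_cast hN
    refine le_trans (mul_nonpos_of_nonneg_of_nonpos (by positivity) (by linarith))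
      (by positivity)
  · set j := (N - M * (m * s + K₂)) / (m * q + K₂) with hj
    have h₁ : j * (m * q + K₂) ≤ N - M * (m * s + K₂) := Nat.div_mul_le_self _ _
    have hsm : ∑ t, m * a t = m * s := by rw [← Finset.mul_sum, hs]
    have h₂ : j * (m * s) ≤ V.comp N := by
      rw [← hsm]
      refine hlow (fun t => m * a t) (fun l => ?_) (m * q) (fun i => ?_) j N ?_
      · push_cast
        simp only [mul_left_comm _ (m : ℤ), ← Finset.mul_sum, ha l, mul_zero]
      · push_cast
        simp only [mul_left_comm _ (m : ℤ), ← Finset.mul_sum]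
        rw [← mul_neg]
        exact mul_le_mul_of_nonneg_left (hD i) (Nat.cast_nonneg m)
      · rw [hsm]
        omega
    have h₃ : N ≤ (j + 1) * (m * q + K₂) + M * (m * s + K₂) := by
      have h : 0 < m * q + K₂ := Nat.add_pos_left (Nat.mul_pos hm hq) _
      have := Nat.lt_div_mul_add (a := N - M * (m * s + K₂)) h
      rw [← hj] at this
      rw [add_mul, one_mul]
      omega
    have h₂' : (j : ℝ) * (m * s) ≤ V.comp N := by exact_mod_cast h₂
    have h₃' : (N : ℝ) ≤ (j + 1) * (m * q + K₂) + M * (m * s + K₂) := by exact_mod_cast h₃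
    push_cast
    calc (m : ℝ) * s * (N - (M * (m * s + K₂) + (m * q + K₂)))
        ≤ m * s * (j * (m * q + K₂)) := by
          refine mul_le_mul_of_nonneg_left ?_ (by positivity)
          linarith
      _ = (m * q + K₂) * (j * (m * s)) := by ring
      _ ≤ (m * q + K₂) * V.comp N := by gcongr

theorem Connected.sq_isBigO_comp (hconn : V.Connected) (hterm : V.Terminating)
    (h : ¬ BddAbove V.objectiveValues) :
    (fun N : ℕ => (N : ℝ) ^ 2) =O[atTop] fun N : ℕ => (V.comp N : ℝ) := by
  obtain ⟨a, ha, hpos, hD⟩ := exists_circulation_of_not_bddAbove h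
  have : Nonempty L := by
    by_contra hL
    rw [not_nonempty_iff] at hL
    have hz : ∑ t, a t = 0 := Finset.sum_eq_zero fun t _ => isEmptyElim t.1.1
    omega
  obtain ⟨K, M, hlow⟩ := hconn.exists_mul_le_comp hterm
  obtain ⟨s, hs⟩ : ∃ s, s = ∑ t, a t := ⟨_, rfl⟩
  rw [← hs] at hpos
  -- For `k ≥ 1`, `k * R` covers both the loss `k * K` over all rounds and the reserve `M * (k * s +
  -- K)`; `+ 1` makes `R` positive.
  obtain ⟨R, hR⟩ : ∃ R, R = K + M * (s + K) + 1 := ⟨_, rfl⟩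
  -- Run `k` rounds that contain `a` exactly `k` times each.
  have hk : ∀ N k : ℕ, 0 < k → k * R ≤ N → k * k ≤ V.comp N := by
    intro N k hk hN
    have hsm : ∑ t, k * a t = k * s := by rw [← Finset.mul_sum, hs]
    have h₂ : k * (k * s) ≤ V.comp N := by
      rw [← hsm]
      refine hlow (fun t => k * a t) (fun l => ?_) 0 (fun i => ?_) k N ?_
      · push_cast
        simp only [mul_left_comm _ (k : ℤ), ← Finset.mul_sum, ha l, mul_zero]
      · push_cast
        simp only [mul_left_comm _ (k : ℤ), ← Finset.mul_sum, neg_zero]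
        exact mul_nonneg (Nat.cast_nonneg k) (hD i)
      · rw [hsm]
        have h₃ : M * K ≤ k * (M * K) := Nat.le_mul_of_pos_left _ hk
        rw [hR] at hN
        nlinarith
    refine le_trans ?_ h₂
    gcongr
    exact Nat.le_mul_of_pos_right _ hpos
  refine IsBigO.of_bound ((2 * R : ℕ) ^ 2 : ℝ) ?_
  filter_upwards [eventually_ge_atTop R] with N hN
  have hRpos : 0 < R := by omega
  have h₁ : 0 < N / R := Nat.div_pos hN hRpos
  have h₂ := hk N (N / R) h₁ (Nat.div_mul_le_self _ _)
  -- Since `N ≥ R`, rounding down loses at most a factor `2`.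
  have h₃ : N ≤ 2 * R * (N / R) := by
    have := Nat.lt_div_mul_add (a := N) hRpos
    nlinarith
  rw [Real.norm_of_nonneg (by positivity), Real.norm_of_nonneg (by positivity)]
  have h₄ : N ^ 2 ≤ (2 * R) ^ 2 * V.comp N := by
    calc N ^ 2 ≤ (2 * R * (N / R)) ^ 2 := Nat.pow_le_pow_left h₃ 2
      _ = (2 * R) ^ 2 * (N / R * (N / R)) := by ring
      _ ≤ _ := by gcongr
  exact_mod_cast h₄

end Asymptotics

end VASS

theorem mainTheorem8 {L : Type*} [Finite L] [DecidableEq L] {d : ℕ} (V : VASS L d)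
    (hconn : V.Connected) (hterm : V.Terminating) :
    (∀ N : ℕ, BddAbove (V.traceLengths N)) ∧
    (∀ c : ℚ, IsGreatest V.objectiveValues c →
      (fun N : ℕ => (V.comp N : ℝ)) ~[atTop] (fun N : ℕ => (c : ℝ) * (N : ℝ))) ∧
    (¬ BddAbove V.objectiveValues →
      (fun N : ℕ => (N : ℝ) ^ 2) =O[atTop] (fun N : ℕ => (V.comp N : ℝ))) :=
  ⟨hterm.bddAbove_traceLengths, fun _ hc => hconn.comp_isEquivalent hterm hc,
    hconn.sq_isBigO_comp hterm⟩
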